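/- Let $L$ be a linear order such that every nonempty open interval $(a,b)=\{x\in L: a<x<b\}$ with $a,b\in L$ is order-isomorphic to $L$. Let $B(L)$ be the interval algebra of $L$, i.e. the Boolean subalgebra of the power set $\mathcal P(L)$ generated by the intervals $[x,y)$ with $x,y\in L$, $x<y$, and let $\operatorname{Ult}(B(L))$ be its Stone space, i.e. the set of ultrafilters of $B(L)$ with the topology generated by the sets $\{F : c\in F\}$, $c\in B(L)$. Call a topological space $X$ homogeneous if for any two points $x,y\in X$ there is a homeomorphism of $X$ onto itself mapping $x$ to $y$. Then $\operatorname{Ult}(B(L))$ is homogeneous if and only if $L$ has neither a strictly increasing nor a strictly decreasing sequence of length $\omega_1$ (that is, indexed by the ordinals below $\omega_1$). In particular, $\operatorname{Ult}(B(L))$ is homogeneous if $L$, with its order topology, is separable. -/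

import Mathlib

/-- The interval algebra `B(L)` of a linear order `L`: the Boolean subalgebra of the power set
of `L` generated by the half-open intervals `[x, y)` with `x < y` in `L`. -/
def intervalAlgebra (L : Type*) [LinearOrder L] : BooleanSubalgebra (Set L) :=
  BooleanSubalgebra.closure {s : Set L | ∃ x y : L, x < y ∧ s = Set.Ico x y}

/-- The set `Ult(B)` of ultrafilters of a Boolean algebra `B`: filters `F` of `B` that do not
contain `0` and that contain `a` or its complement for every `a` in `B`. -/
def Ult (B : Type*) [BooleanAlgebra B] : Type _ :=
  {F : Order.PFilter B // ⊥ ∉ F ∧ ∀ a : B, a ∈ F ∨ aᶜ ∈ F}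

/-- The Stone topology on `Ult(B)`, generated by the sets of all ultrafilters containing `a`,
for `a` in `B`. -/
instance Ult.instTopologicalSpace (B : Type*) [BooleanAlgebra B] : TopologicalSpace (Ult B) :=
  TopologicalSpace.generateFrom {U : Set (Ult B) | ∃ a : B, U = {F : Ult B | a ∈ F.1}}

/-- A topological space is homogeneous if any point is mapped to any other point by some
autohomeomorphism. -/
def IsHomogeneousSpace (X : Type*) [TopologicalSpace X] : Prop :=
  ∀ x y : X, ∃ h : X ≃ₜ X, h x = y

/-- `L` has a strictly increasing sequence indexed by the ordinals below `ω₁`. -/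
def HasIncreasingOmegaOneSeq (L : Type*) [LinearOrder L] : Prop :=
  ∃ f : Set.Iio (Ordinal.omega 1 : Ordinal.{0}) → L, StrictMono f

/-- `L` has a strictly decreasing sequence indexed by the ordinals below `ω₁`. -/
def HasDecreasingOmegaOneSeq (L : Type*) [LinearOrder L] : Prop :=
  ∃ f : Set.Iio (Ordinal.omega 1 : Ordinal.{0}) → L, StrictAnti f

/-! If no three points `a < c < b` exist, `L` and its Stone space are finite, the space is discrete,
and both sides hold. Otherwise the self-similarity makes `L` dense without endpoints.

Without ω₁-sequences, cofinalities and coinitialities are countable, so every ultrafilter is the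
only point of some countable intersection of clopen sets. The Stone spaces of all intervals `[x, y)`
are homeomorphic to one space `K`, and splitting an interval gives `K ⊕ K ≃ K`; hence `K` is the
Stone space of every nonempty bounded element, and in the end of every nonzero one. Peeling off a
decreasing sequence of clopen neighbourhoods of `F` leaves countably many copies of `K`, so the
whole space is the one-point compactification of their sum with `F` at infinity
(`exists_homeomorph_onePoint`). Since `F` is arbitrary, the space is homogeneous.

Conversely, the principal ultrafilter at a point is either a Gδ point or a P-point
(`isGδ_or_isPPoint_pointUlt`). Not every point is a P-point, by compactness, so homogeneity makes
every point Gδ. A bounded ω₁-sequence, however, defines a cut whose ultrafilter is not Gδ, and any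
ω₁-sequence can be moved into a bounded interval. -/

namespace Ult

/-! ### Stone spaces of Boolean algebras -/

section Basic

variable {B : Type*} [BooleanAlgebra B]

theorem mem_of_le {F : Ult B} {a b : B} (hab : a ≤ b) (ha : a ∈ F.1) : b ∈ F.1 :=
  Order.PFilter.mem_of_le hab ha

theorem compl_mem_iff {F : Ult B} {a : B} : aᶜ ∈ F.1 ↔ a ∉ F.1 := by
  refine ⟨fun h h' => F.2.1 ?_, fun h => (F.2.2 a).resolve_left h⟩
  simpa using Order.PFilter.inf_mem h h'

theorem inf_mem_iff {F : Ult B} {a b : B} : a ⊓ b ∈ F.1 ↔ a ∈ F.1 ∧ b ∈ F.1 :=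
  Order.PFilter.inf_mem_iff

theorem sup_mem_iff {F : Ult B} {a b : B} : a ⊔ b ∈ F.1 ↔ a ∈ F.1 ∨ b ∈ F.1 := by
  rw [← not_iff_not, ← compl_mem_iff, compl_sup, inf_mem_iff, compl_mem_iff, compl_mem_iff, not_or]

theorem sdiff_mem_iff {F : Ult B} {a b : B} : a \ b ∈ F.1 ↔ a ∈ F.1 ∧ b ∉ F.1 := by
  rw [sdiff_eq, inf_mem_iff, compl_mem_iff]

theorem top_mem (F : Ult B) : (⊤ : B) ∈ F.1 := Order.PFilter.top_mem

theorem ext_of_mem {F G : Ult B} (h : ∀ a ∈ F.1, a ∈ G.1) : F = G := by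
  refine Subtype.ext (SetLike.ext fun a => ⟨h a, fun ha => ?_⟩)
  by_contra hF
  exact compl_mem_iff.1 (h _ (compl_mem_iff.2 hF)) ha

/-- The ultrafilter with a given set of members. -/
def ofSet (S : Set B) (htop : ⊤ ∈ S) (hbot : ⊥ ∉ S) (hinf : ∀ a ∈ S, ∀ b ∈ S, a ⊓ b ∈ S)
    (hup : ∀ a b : B, a ≤ b → a ∈ S → b ∈ S) (hcompl : ∀ a, a ∈ S ∨ aᶜ ∈ S) : Ult B :=
  ⟨(Order.IsPFilter.of_def (F := S) ⟨⊤, htop⟩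
    (fun a ha b hb => ⟨a ⊓ b, hinf a ha b hb, inf_le_left, inf_le_right⟩)
    (fun {a b} h ha => hup a b h ha)).toPFilter, hbot, hcompl⟩

/-- The clopen set of ultrafilters containing `a`. -/
def basic (a : B) : Set (Ult B) := {F | a ∈ F.1}

@[simp] theorem mem_basic {a : B} {F : Ult B} : F ∈ basic a ↔ a ∈ F.1 := Iff.rfl

theorem isOpen_basic (a : B) : IsOpen (basic a) :=
  TopologicalSpace.isOpen_generateFrom_of_mem ⟨a, rfl⟩

theorem isClosed_basic (a : B) : IsClosed (basic a) := by
  rw [← isOpen_compl_iff]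
  convert isOpen_basic aᶜ using 1
  ext F
  simp [compl_mem_iff]

theorem isTopologicalBasis :
    TopologicalSpace.IsTopologicalBasis {U : Set (Ult B) | ∃ a : B, U = basic a} := by
  refine ⟨?_, ?_, rfl⟩
  · rintro _ ⟨a, rfl⟩ _ ⟨b, rfl⟩ F ⟨ha, hb⟩
    exact ⟨basic (a ⊓ b), ⟨_, rfl⟩, inf_mem_iff.2 ⟨ha, hb⟩, fun G hG => inf_mem_iff.1 hG⟩
  · exact Set.eq_univ_of_forall fun F => ⟨basic ⊤, ⟨_, rfl⟩, top_mem F⟩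

theorem mem_nhds_iff {F : Ult B} {U : Set (Ult B)} :
    U ∈ nhds F ↔ ∃ a ∈ F.1, basic a ⊆ U := by
  rw [isTopologicalBasis.mem_nhds_iff]
  constructor
  · rintro ⟨_, ⟨a, rfl⟩, ha, hU⟩
    exact ⟨a, ha, hU⟩
  · rintro ⟨a, ha, hU⟩
    exact ⟨_, ⟨a, rfl⟩, ha, hU⟩

theorem exists_mem_notMem {F G : Ult B} (h : F ≠ G) : ∃ a ∈ F.1, a ∉ G.1 := by
  by_contra! h'
  exact h (ext_of_mem h')

instance : T2Space (Ult B) := by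
  refine ⟨fun F G h => ?_⟩
  obtain ⟨a, ha, ha'⟩ := exists_mem_notMem h
  refine ⟨basic a, basic aᶜ, isOpen_basic _, isOpen_basic _, ha, compl_mem_iff.2 ha', ?_⟩
  rw [Set.disjoint_left]
  exact fun H h1 h2 => compl_mem_iff.1 h2 h1

/-- The Boolean prime ideal theorem, in terms of ultrafilters. -/
theorem exists_forall_notMem (I : Order.Ideal B) (h : ⊤ ∉ I) : ∃ F : Ult B, ∀ a ∈ I, a ∉ F.1 := by
  obtain ⟨J, hJ, hIJ, hd⟩ := DistribLattice.prime_ideal_of_disjoint_filter_ideal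
    (F := Order.PFilter.principal (⊤ : B)) (I := I) (by
      rw [Set.disjoint_left]
      intro a ha ha'
      have : a = ⊤ := top_le_iff.1 ha
      exact h (this ▸ ha'))
  have htop : (⊤ : B) ∉ J := fun h' => Set.disjoint_left.1 hd (by exact le_rfl) h'
  refine ⟨ofSet {a | a ∉ J} htop (by simp) (fun a ha b hb hab => ?_) (fun a b hab ha hb => ?_)
    (fun a => ?_), fun a ha ha' => ha' (hIJ ha)⟩
  · exact (hJ.mem_or_mem hab).elim ha hb
  · exact ha (J.lower hab hb)
  · by_contra! hc
    have h1 := not_not.1 hc.1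
    have h2 := not_not.1 hc.2
    exact htop (by simpa using Order.Ideal.sup_mem h1 h2)

theorem nonempty_basic {a : B} (ha : a ≠ ⊥) : (basic a).Nonempty := by
  obtain ⟨F, hF⟩ := exists_forall_notMem (Order.Ideal.principal aᶜ) (by
    simpa [Order.Ideal.mem_principal, top_le_iff] using ha)
  exact ⟨F, by simpa [compl_mem_iff] using hF aᶜ (by simp)⟩

theorem basic_subset_iff {a b : B} : basic a ⊆ basic b ↔ a ≤ b := by
  refine ⟨fun h => ?_, fun h F hF => mem_of_le h hF⟩
  by_contra hab
  obtain ⟨F, hF⟩ := nonempty_basic (a := a \ b) (by simpa [sdiff_eq_bot_iff] using hab)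
  exact (sdiff_mem_iff.1 hF).2 (h (sdiff_mem_iff.1 hF).1)

theorem exists_mem_of_mem_finset_sup {F : Ult B} (t : Finset B) (h : t.sup id ∈ F.1) :
    ∃ a ∈ t, a ∈ F.1 := by
  classical
  induction t using Finset.induction_on with
  | empty => exact absurd h F.2.1
  | insert a t _ ih =>
    rw [Finset.sup_insert] at h
    rcases sup_mem_iff.1 h with h | h
    · exact ⟨a, by simp, h⟩
    · obtain ⟨b, hb, hb'⟩ := ih h
      exact ⟨b, by simp [hb], hb'⟩

instance : CompactSpace (Ult B) := by
  classical
  -- By Alexander's subbase theorem only covers by basic sets matter. Without a finite subcover, the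
  -- ideal generated by the cover is proper, and an ultrafilter avoiding it is uncovered.
  refine ⟨isCompact_generateFrom rfl fun P hP hcov => ?_⟩
  set A : Set B := {a | basic a ∈ P}
  let I : Order.Ideal B :=
    { carrier := {b | ∃ t : Finset B, (t : Set B) ⊆ A ∧ b ≤ t.sup id}
      lower' := fun b c hcb ⟨t, ht, hb⟩ => ⟨t, ht, hcb.trans hb⟩
      nonempty' := ⟨⊥, ∅, by simp, by simp⟩
      directed' := by
        rintro b ⟨t, ht, hb⟩ c ⟨s, hs, hc⟩
        refine ⟨b ⊔ c, ⟨t ∪ s, by simp [ht, hs], ?_⟩, le_sup_left, le_sup_right⟩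
        rw [Finset.sup_union]
        exact sup_le_sup hb hc }
  by_cases htop : ⊤ ∈ I
  · obtain ⟨t, ht, htt⟩ := htop
    refine ⟨basic '' (t : Set B), by rintro _ ⟨a, ha, rfl⟩; exact ht ha,
      t.finite_toSet.image _, fun F _ => ?_⟩
    obtain ⟨a, ha, haF⟩ := exists_mem_of_mem_finset_sup t (mem_of_le htt (top_mem F))
    exact ⟨basic a, ⟨a, ha, rfl⟩, haF⟩
  · obtain ⟨F, hF⟩ := exists_forall_notMem I htop
    obtain ⟨U, hU, hFU⟩ := hcov (Set.mem_univ F)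
    obtain ⟨a, rfl⟩ := hP hU
    exact absurd hFU (hF a ⟨{a}, (by
      simpa only [Finset.coe_singleton, Set.singleton_subset_iff] using! hU), by simp⟩)

end Basic

/-! ### Relative algebras and clopen subspaces -/

section Relative

variable {B : Type*} [BooleanAlgebra B]

/-- The ultrafilter containing `b` that corresponds to an ultrafilter containing `a` under an
isomorphism of the Boolean algebras below `a` and below `b`. -/
def transport {a b : B} (e : Set.Iic a ≃o Set.Iic b) (F : Ult B) (ha : a ∈ F.1) : Ult B := by
  refine ofSet {c | (e.symm ⟨c ⊓ b, inf_le_right⟩ : B) ∈ F.1} ?_ ?_ ?_ ?_ ?_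
  · have : (⟨⊤ ⊓ b, inf_le_right⟩ : Set.Iic b) = ⊤ := Subtype.ext (by simp)
    change (e.symm _ : B) ∈ F.1
    rw [this, map_top]
    exact ha
  · have : (⟨⊥ ⊓ b, inf_le_right⟩ : Set.Iic b) = ⊥ := Subtype.ext (by simp)
    change (e.symm _ : B) ∉ F.1
    rw [this, map_bot]
    exact F.2.1
  · intro c hc d hd
    have : (⟨c ⊓ d ⊓ b, inf_le_right⟩ : Set.Iic b)
        = ⟨c ⊓ b, inf_le_right⟩ ⊓ ⟨d ⊓ b, inf_le_right⟩ :=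
      Subtype.ext (by simp [inf_inf_distrib_right])
    simp only [Set.mem_ofPred_eq, this, map_inf] at hc hd ⊢
    exact inf_mem_iff.2 ⟨hc, hd⟩
  · intro c d hcd hc
    refine mem_of_le ?_ hc
    exact e.symm.monotone (show (⟨c ⊓ b, inf_le_right⟩ : Set.Iic b) ≤ ⟨d ⊓ b, inf_le_right⟩ from
      inf_le_inf_right b hcd)
  · intro c
    have : (⟨c ⊓ b, inf_le_right⟩ : Set.Iic b) ⊔ ⟨cᶜ ⊓ b, inf_le_right⟩ = ⊤ :=
      Subtype.ext (by simp [← inf_sup_right])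
    have h2 := congrArg (fun z => (e.symm z : B)) this
    simp only [map_sup, map_top] at h2
    refine sup_mem_iff.1 (?_ : (e.symm ⟨c ⊓ b, inf_le_right⟩ : B) ⊔ _ ∈ F.1)
    have h3 : (e.symm ⟨c ⊓ b, inf_le_right⟩ : B) ⊔ (e.symm ⟨cᶜ ⊓ b, inf_le_right⟩ : B) = a := h2
    rw [h3]
    exact ha

theorem mem_transport {a b : B} {e : Set.Iic a ≃o Set.Iic b} {F : Ult B} {ha : a ∈ F.1} {c : B} :
    c ∈ (transport e F ha).1 ↔ (e.symm ⟨c ⊓ b, inf_le_right⟩ : B) ∈ F.1 := Iff.rfl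

theorem mem_transport_self {a b : B} (e : Set.Iic a ≃o Set.Iic b) (F : Ult B) (ha : a ∈ F.1) :
    b ∈ (transport e F ha).1 := by
  have : (⟨b ⊓ b, inf_le_right⟩ : Set.Iic b) = ⊤ := Subtype.ext (by simp)
  rw [mem_transport, this]
  simpa using ha

theorem transport_symm {a b : B} (e : Set.Iic a ≃o Set.Iic b) (F : Ult B) (ha : a ∈ F.1) :
    transport e.symm (transport e F ha) (mem_transport_self e F ha) = F := by
  refine (ext_of_mem fun c hc => ?_).symm
  rw [mem_transport, mem_transport]
  have : (⟨(e.symm.symm ⟨c ⊓ a, inf_le_right⟩ : B) ⊓ b, inf_le_right⟩ : Set.Iic b)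
      = e ⟨c ⊓ a, inf_le_right⟩ :=
    Subtype.ext (inf_eq_left.2 (e ⟨c ⊓ a, inf_le_right⟩).2)
  rw [this]
  simpa using inf_mem_iff.2 ⟨hc, ha⟩

theorem continuous_transport {a b : B} (e : Set.Iic a ≃o Set.Iic b) :
    Continuous fun F : basic a => transport e F.1 F.2 := by
  refine continuous_generateFrom_iff.2 ?_
  rintro _ ⟨c, rfl⟩
  exact (isOpen_basic (e.symm ⟨c ⊓ b, inf_le_right⟩ : B)).preimage continuous_subtype_val

/-- Isomorphic relative algebras have homeomorphic clopen sets of ultrafilters. -/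
def basicHomeomorph {a b : B} (e : Set.Iic a ≃o Set.Iic b) : basic a ≃ₜ basic b where
  toFun F := ⟨transport e F.1 F.2, mem_transport_self e F.1 F.2⟩
  invFun F := ⟨transport e.symm F.1 F.2, mem_transport_self e.symm F.1 F.2⟩
  left_inv F := Subtype.ext (transport_symm e F.1 F.2)
  right_inv F := Subtype.ext (transport_symm e.symm F.1 F.2)
  continuous_toFun := (continuous_transport e).subtype_mk _
  continuous_invFun := (continuous_transport e.symm).subtype_mk _

instance (a : B) : CompactSpace (basic a) :=
  isCompact_iff_compactSpace.1 (isClosed_basic a).isCompact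

/-- The clopen set of a join of disjoint elements is a topological sum. -/
noncomputable def sumHomeomorph {a b : B} (h : Disjoint a b) :
    (basic a ⊕ basic b) ≃ₜ basic (a ⊔ b) := by
  have hl : basic a ⊆ basic (a ⊔ b) := basic_subset_iff.2 le_sup_left
  have hr : basic b ⊆ basic (a ⊔ b) := basic_subset_iff.2 le_sup_right
  let f : basic a ⊕ basic b → basic (a ⊔ b) := Sum.elim (Set.inclusion hl) (Set.inclusion hr)
  have hd : Disjoint (basic a) (basic b) :=
    Set.disjoint_left.2 fun F ha hb =>
      F.2.1 (mem_of_le h.le_bot (inf_mem_iff.2 ⟨ha, hb⟩))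
  have hf : Function.Bijective f := by
    constructor
    · rintro (x | x) (y | y) hxy
      · exact congrArg Sum.inl (Set.inclusion_injective hl hxy)
      · exact absurd (congrArg Subtype.val hxy) (hd.ne_of_mem x.2 y.2)
      · exact absurd (congrArg Subtype.val hxy).symm (hd.ne_of_mem y.2 x.2)
      · exact congrArg Sum.inr (Set.inclusion_injective hr hxy)
    · rintro ⟨F, hF⟩
      rcases sup_mem_iff.1 hF with h | h
      · exact ⟨Sum.inl ⟨F, h⟩, rfl⟩
      · exact ⟨Sum.inr ⟨F, h⟩, rfl⟩
  exact Continuous.homeoOfEquivCompactToT2 (f := Equiv.ofBijective f hf)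
    ((continuous_inclusion hl).sumElim (continuous_inclusion hr))

end Relative

/-! ### Countably determined points and one-point compactifications -/

section Pointed

variable {B : Type*} [BooleanAlgebra B]

/-- The singleton `{F}` is a countable intersection of basic clopen sets. -/
def IsCountablyDetermined (F : Ult B) : Prop := ∃ V : ℕ → B, ∀ G : Ult B, G = F ↔ ∀ n, V n ∈ G.1

theorem exists_strictAnti_of_isCountablyDetermined {F : Ult B} (hF : IsCountablyDetermined F)
    (hiso : ∀ a ∈ F.1, ∃ G, G ≠ F ∧ a ∈ G.1) {c : B} (hc : c ∈ F.1) :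
    ∃ W : ℕ → B, StrictAnti W ∧ W 0 = c ∧ ∀ G : Ult B, G = F ↔ ∀ n, W n ∈ G.1 := by
  obtain ⟨V, hV⟩ := hF
  have hVF := (hV F).1 rfl
  have step : ∀ (n : ℕ) (W : {W : B // W ∈ F.1}), ∃ W' : {W : B // W ∈ F.1},
      W'.1 < W.1 ∧ W'.1 ≤ V n := by
    rintro n ⟨W, hW⟩
    obtain ⟨G, hne, hG⟩ := hiso W hW
    have : ¬ ∀ n, V n ∈ G.1 := fun h => hne ((hV G).2 h)
    push Not at this
    obtain ⟨m, hm⟩ := this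
    -- `V n` keeps the sequence determining `F`; `V m`, missed by some `G ≠ F` containing `W`, makes
    -- the descent strict.
    refine ⟨⟨W ⊓ (V n ⊓ V m), inf_mem_iff.2 ⟨hW, inf_mem_iff.2 ⟨hVF n, hVF m⟩⟩⟩,
      lt_of_le_of_ne inf_le_left fun h => hm ?_, inf_le_right.trans inf_le_left⟩
    exact mem_of_le ((inf_eq_left.1 h).trans inf_le_right) hG
  choose next h1 h2 using step
  let W : ℕ → {W : B // W ∈ F.1} := fun n => Nat.rec ⟨c, hc⟩ next n
  have hsucc : ∀ n, W (n + 1) = next n (W n) := fun n => rfl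
  refine ⟨fun n => (W n).1, strictAnti_nat_of_succ_lt fun n => by rw [hsucc]; exact h1 n _, rfl,
    fun G => ⟨?_, fun h => (hV G).2 fun n => ?_⟩⟩
  · rintro rfl n
    exact (W n).2
  · exact mem_of_le (h2 n (W n)) (hsucc n ▸ h (n + 1))

open OnePoint in
/-- If every nonempty clopen subset of `basic c` missing `F` is homeomorphic to `K`, and `F` is a
countably determined limit point, then `basic c` is the one-point compactification, with `F` at
infinity, of the sum of countably many copies of `K`. -/
theorem exists_homeomorph_onePoint {K : Type*} [TopologicalSpace K] {F : Ult B}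
    (hF : IsCountablyDetermined F) (hiso : ∀ a ∈ F.1, ∃ G, G ≠ F ∧ a ∈ G.1) {c : B}
    (hc : c ∈ F.1) (hK : ∀ d ≤ c, d ≠ ⊥ → d ∉ F.1 → Nonempty (K ≃ₜ basic d)) :
    ∃ h : OnePoint (Σ _ : ℕ, K) ≃ₜ basic c, h ∞ = ⟨F, hc⟩ := by
  obtain ⟨W, hanti, h0, hW⟩ := exists_strictAnti_of_isCountablyDetermined hF hiso hc
  have hWF := (hW F).1 rfl
  have hle : ∀ n, W n \ W (n + 1) ≤ c := fun n =>
    sdiff_le.trans (h0 ▸ hanti.antitone (Nat.zero_le n))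
  have hd : ∀ n, Nonempty (K ≃ₜ basic (W n \ W (n + 1))) := fun n =>
    hK _ (hle n) (fun h => (hanti (Nat.lt_succ_self n)).not_ge (sdiff_eq_bot_iff.1 h))
      fun h => (sdiff_mem_iff.1 h).2 (hWF (n + 1))
  let e : ∀ n, K ≃ₜ basic (W n \ W (n + 1)) := fun n => (hd n).some
  have hsub : ∀ n, basic (W n \ W (n + 1)) ⊆ basic c := fun n => basic_subset_iff.2 (hle n)
  -- The layers `W n \ W (n + 1)` partition `basic c` minus `F` into clopen copies of `K`.
  let f : (Σ _ : ℕ, K) → basic c := fun x => Set.inclusion (hsub x.1) (e x.1 x.2)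
  have hmem : ∀ x, W x.1 \ W (x.1 + 1) ∈ (f x).1.1 := fun x => (e x.1 x.2).2
  have hdisj : ∀ x y, x.1 < y.1 → f x ≠ f y := by
    intro x y hxy h
    refine (sdiff_mem_iff.1 (hmem x)).2 ?_
    rw [h]
    exact mem_of_le (hanti.antitone hxy) (sdiff_mem_iff.1 (hmem y)).1
  have hinj : Function.Injective f := by
    rintro ⟨n, x⟩ ⟨m, y⟩ h
    rcases lt_trichotomy n m with hnm | rfl | hnm
    · exact absurd h (hdisj _ _ hnm)
    · have := (e n).injective (Set.inclusion_injective _ h)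
      exact congrArg (Sigma.mk n) this
    · exact absurd h.symm (hdisj _ _ hnm)
  have hemb : Topology.IsOpenEmbedding f := by
    refine Topology.IsOpenEmbedding.of_continuous_injective_isOpenMap ?_ hinj ?_
    · exact continuous_sigma fun n => (continuous_inclusion (hsub n)).comp (e n).continuous
    · refine isOpenMap_sigma.2 fun n => IsOpenMap.comp
        (g := Set.inclusion (hsub n)) ?_ (e n).isOpenMap
      refine Topology.IsOpenEmbedding.isOpenMap ⟨Topology.IsEmbedding.inclusion _, ?_⟩
      rw [Set.range_inclusion]
      exact (isOpen_basic _).preimage continuous_subtype_val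
  have hrange : Set.range f = {⟨F, hc⟩}ᶜ := by
    ext ⟨G, hG⟩
    rw [Set.mem_range, Set.mem_compl_iff, Set.mem_singleton_iff, Subtype.ext_iff]
    constructor
    · rintro ⟨x, hx⟩ rfl
      have := hmem x
      rw [hx] at this
      exact (sdiff_mem_iff.1 this).2 (hWF _)
    · intro hne
      have : ∃ n, W n ∉ G.1 := by
        by_contra! h
        exact hne ((hW G).2 h)
      classical
      obtain ⟨n, hn⟩ : ∃ n, Nat.find this = n + 1 := by
        refine Nat.exists_eq_succ_of_ne_zero fun h => ?_
        have := Nat.find_spec this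
        rw [h, h0] at this
        exact this hG
      have h1 : W (n + 1) ∉ G.1 := hn ▸ Nat.find_spec this
      have h2 : W n ∈ G.1 := not_not.1 (Nat.find_min this (by omega))
      refine ⟨⟨n, (e n).symm ⟨G, sdiff_mem_iff.2 ⟨h2, h1⟩⟩⟩, ?_⟩
      simp [f]
  exact ⟨equivOfIsEmbeddingOfRangeEq _ f hemb.isEmbedding hrange, rfl⟩

end Pointed

end Ult

/-! ### Sequences of length ω₁ and countable cofinality -/

section OmegaOne

theorem countable_Iio_of_mem_Iio_omega_one (α : Set.Iio (Ordinal.omega 1 : Ordinal.{0})) :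
    (Set.Iio α).Countable := by
  have h : (Set.Iio α.1).Countable := by
    rw [← Cardinal.le_aleph0_iff_set_countable, Cardinal.mk_Iio_ordinal, Cardinal.lift_le_aleph0,
      ← Order.lt_succ_iff, Cardinal.succ_aleph0, ← Cardinal.lt_ord, Cardinal.ord_aleph]
    exact α.2
  exact h.preimage Subtype.val_injective

theorem exists_lt_succ_omega_one (α : Set.Iio (Ordinal.omega 1 : Ordinal.{0})) :
    ∃ β : Set.Iio (Ordinal.omega 1 : Ordinal.{0}), α < β ∧ ∀ γ, α < γ → β ≤ γ :=
  ⟨⟨Order.succ α.1, (Cardinal.isSuccLimit_omega 1).succ_lt α.2⟩, Order.lt_succ α.1,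
    fun _ h => Order.succ_le_of_lt (Subtype.coe_lt_coe.2 h)⟩

theorem exists_gt_of_countable_omega_one {C : Set (Set.Iio (Ordinal.omega 1 : Ordinal.{0}))}
    (hC : C.Countable) : ∃ α, ∀ β ∈ C, β < α := by
  have := hC.to_subtype
  have hlt : ⨆ β : C, Order.succ β.1.1 < Ordinal.omega 1 :=
    Ordinal.iSup_lt_omega_one fun β => (Cardinal.isSuccLimit_omega 1).succ_lt β.1.2
  refine ⟨⟨_, hlt⟩, fun β hβ => ?_⟩
  exact (Order.lt_succ β.1).trans_le
    (Ordinal.le_iSup (fun β : C => Order.succ β.1.1) ⟨β, hβ⟩)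

theorem uncountable_Iio_omega_one : Uncountable (Set.Iio (Ordinal.omega 1 : Ordinal.{0})) := by
  by_contra h
  rw [not_uncountable_iff] at h
  obtain ⟨α, hα⟩ := exists_gt_of_countable_omega_one (Set.countable_univ)
  exact lt_irrefl α (hα α (Set.mem_univ α))

variable {L : Type*} [LinearOrder L]

/-- Otherwise every countable subset of `S` has a strict upper bound in `S`, and transfinite
recursion along ω₁, whose initial segments are countable, builds an increasing sequence. -/
theorem exists_countable_cofinal (h : ¬ HasIncreasingOmegaOneSeq L) (S : Set L) :
    ∃ C ⊆ S, C.Countable ∧ ∀ d ∈ S, ∃ c ∈ C, d ≤ c := by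
  by_contra! hS
  have : Nonempty L := ⟨(hS ∅ (Set.empty_subset _) Set.countable_empty).choose⟩
  have hS' : ∀ C : Set L, ∃ d, C ⊆ S → C.Countable → d ∈ S ∧ ∀ c ∈ C, c < d := by
    intro C
    by_cases hC : C ⊆ S ∧ C.Countable
    · obtain ⟨d, hd⟩ := hS C hC.1 hC.2
      exact ⟨d, fun _ _ => hd⟩
    · exact ⟨Classical.arbitrary L, fun h1 h2 => absurd ⟨h1, h2⟩ hC⟩
  choose g hg using hS'
  let W : (α : Set.Iio (Ordinal.omega 1 : Ordinal.{0})) →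
      ((β : Set.Iio (Ordinal.omega 1 : Ordinal.{0})) → β < α → L) → L :=
    fun α f => g (Set.range fun β : Set.Iio α => f β.1 β.2)
  let f := IsWellFounded.fix (· < ·) W
  have hf : ∀ α, f α = g (f '' Set.Iio α) := by
    intro α
    rw [Set.image_eq_range]
    exact IsWellFounded.fix_eq (· < ·) W α
  have hcount : ∀ α, (f '' Set.Iio α).Countable := fun α =>
    (countable_Iio_of_mem_Iio_omega_one α).image f
  have hfS : ∀ α, f α ∈ S := by
    intro α
    induction α using WellFoundedLT.induction with
    | ind α ih =>
      rw [hf]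
      exact (hg _ (by rintro _ ⟨β, hβ, rfl⟩; exact ih β hβ) (hcount α)).1
  refine h ⟨f, fun β α hβα => ?_⟩
  rw [hf α]
  exact (hg _ (by rintro _ ⟨β, hβ, rfl⟩; exact hfS β) (hcount α)).2 _ ⟨β, hβα, rfl⟩

theorem exists_countable_coinitial (h : ¬ HasDecreasingOmegaOneSeq L) (S : Set L) :
    ∃ C ⊆ S, C.Countable ∧ ∀ d ∈ S, ∃ c ∈ C, c ≤ d := by
  have h' : ¬ HasIncreasingOmegaOneSeq Lᵒᵈ := fun ⟨f, hf⟩ =>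
    h ⟨fun α => OrderDual.ofDual (f α), fun _ _ hab => OrderDual.toDual_lt_toDual.1 (hf hab)⟩
  exact exists_countable_cofinal h' S

theorem exists_forall_lt_of_strictMono {f : Set.Iio (Ordinal.omega 1 : Ordinal.{0}) → L}
    (hf : StrictMono f) {C : Set L} (hC : C.Countable) (hCf : ∀ c ∈ C, ∃ α, c ≤ f α) :
    ∃ α, ∀ c ∈ C, c < f α := by
  have := (exists_gt_of_countable_omega_one Set.countable_empty).nonempty
  choose! g hg using hCf
  obtain ⟨α, hα⟩ := exists_gt_of_countable_omega_one (hC.image g)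
  exact ⟨α, fun c hc => (hg c hc).trans_lt (hf (hα _ ⟨c, hc, rfl⟩))⟩

theorem exists_forall_gt_of_strictAnti {f : Set.Iio (Ordinal.omega 1 : Ordinal.{0}) → L}
    (hf : StrictAnti f) {C : Set L} (hC : C.Countable) (hCf : ∀ c ∈ C, ∃ α, f α ≤ c) :
    ∃ α, ∀ c ∈ C, f α < c := by
  have := (exists_gt_of_countable_omega_one Set.countable_empty).nonempty
  choose! g hg using hCf
  obtain ⟨α, hα⟩ := exists_gt_of_countable_omega_one (hC.image g)
  exact ⟨α, fun c hc => (hf (hα _ ⟨c, hc, rfl⟩)).trans_le (hg c hc)⟩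

end OmegaOne

/-! ### Self-similarity forces density and no endpoints -/

section Dense

variable {L : Type*} [LinearOrder L]

/-- A least element of `L` would give one to every nonempty open interval, while no open interval is
a singleton. With `m` least in `(z, b)`, either `(m, b)` is empty and `(z, b) = {m}`, or it has a
least element `m₂` and `(z, m₂) = {m}`. -/
theorem not_exists_isLeast_univ (hL : ∀ a b : L, (Set.Ioo a b).Nonempty → Nonempty (Set.Ioo a b ≃o L))
    {a c b : L} (hac : a < c) (hcb : c < b) (z : L) : ∃ x, x < z := by
  by_contra! hz
  have hleast : ∀ x y : L, (Set.Ioo x y).Nonempty → ∃ m ∈ Set.Ioo x y, ∀ w ∈ Set.Ioo x y, m ≤ w := by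
    intro x y h
    obtain ⟨e⟩ := hL x y h
    exact ⟨e.symm z, (e.symm z).2, fun w hw => Subtype.coe_le_coe.2 (e.symm_apply_le.2 (hz (e ⟨w, hw⟩)))⟩
  have hsing : ∀ x y m : L, m ∈ Set.Ioo x y → ∃ w ∈ Set.Ioo x y, w ≠ m := by
    intro x y m hm
    by_contra! h
    obtain ⟨e⟩ := hL x y ⟨m, hm⟩
    have : e.symm a = e.symm b :=
      Subtype.ext ((h _ (e.symm a).2).trans (h _ (e.symm b).2).symm)
    exact (hac.trans hcb).ne (e.symm.injective this)
  obtain ⟨m, hm, hmle⟩ := hleast z b ⟨c, (hz a).trans_lt hac, hcb⟩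
  by_cases hne : (Set.Ioo m b).Nonempty
  · obtain ⟨m₂, hm₂, hm₂le⟩ := hleast m b hne
    obtain ⟨w, hw, hwm⟩ := hsing z m₂ m ⟨hm.1, hm₂.1⟩
    have hwb : w < b := hw.2.trans hm₂.2
    have hmw : m < w := lt_of_le_of_ne (hmle w ⟨hw.1, hwb⟩) hwm.symm
    exact (hm₂le w ⟨hmw, hwb⟩).not_gt hw.2
  · obtain ⟨w, hw, hwm⟩ := hsing z b m hm
    exact hne ⟨w, lt_of_le_of_ne (hmle w hw) hwm.symm, hw.2⟩

theorem not_exists_isGreatest_univ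
    (hL : ∀ a b : L, (Set.Ioo a b).Nonempty → Nonempty (Set.Ioo a b ≃o L))
    {a c b : L} (hac : a < c) (hcb : c < b) (z : L) : ∃ x, z < x := by
  refine not_exists_isLeast_univ (L := Lᵒᵈ) (fun x y h => ?_) (a := OrderDual.toDual b)
    (c := OrderDual.toDual c) (b := OrderDual.toDual a) hcb hac (OrderDual.toDual z)
  obtain ⟨w, hw⟩ := h
  obtain ⟨e⟩ := hL (OrderDual.ofDual y) (OrderDual.ofDual x) ⟨OrderDual.ofDual w, hw.2, hw.1⟩
  exact ⟨{ toFun := fun u => OrderDual.toDual (e ⟨OrderDual.ofDual u.1, u.2.2, u.2.1⟩)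
           invFun := fun u => ⟨OrderDual.toDual (e.symm (OrderDual.ofDual u)).1,
            (e.symm (OrderDual.ofDual u)).2.2, (e.symm (OrderDual.ofDual u)).2.1⟩
           left_inv := fun u => by simp
           right_inv := fun u => by simp
           map_rel_iff' := fun {u v} => by
            simp [OrderDual.toDual_le_toDual, ← Subtype.coe_le_coe] }⟩

theorem exists_between_of_ioo_orderIso
    (hL : ∀ a b : L, (Set.Ioo a b).Nonempty → Nonempty (Set.Ioo a b ≃o L))
    {a c b : L} (hac : a < c) (hcb : c < b) {x y : L} (hxy : x < y) : ∃ z, x < z ∧ z < y := by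
  by_contra! h
  obtain ⟨z, hz⟩ := not_exists_isGreatest_univ hL hac hcb y
  -- With nothing between `x` and `y`, the point `y` would be least in `(x, z)`, a copy of `L`.
  obtain ⟨e⟩ := hL x z ⟨y, hxy, hz⟩
  obtain ⟨w, hw⟩ := not_exists_isLeast_univ hL hac hcb (e ⟨y, hxy, hz⟩)
  have h1 : (e.symm w).1 < y := Subtype.coe_lt_coe.2 (e.symm_apply_lt.2 hw)
  exact (h _ (e.symm w).2.1).not_gt h1

end Dense

open Ult

/-! ### Ultrafilters of the interval algebra as cuts -/

section Cuts

variable {L : Type*} [LinearOrder L]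

/-- The interval `[x, y)` as an element of the interval algebra. -/
def icoElem (x y : L) : intervalAlgebra L :=
  ⟨Set.Ico x y, by
    rcases lt_or_ge x y with h | h
    · exact BooleanSubalgebra.subset_closure ⟨x, y, h, rfl⟩
    · rw [Set.Ico_eq_empty h.not_gt]
      exact BooleanSubalgebra.bot_mem⟩

theorem eq_bot_of_forall_notMem {a : intervalAlgebra L} (h : ∀ u, u ∉ a.1) : a = ⊥ :=
  Subtype.ext (Set.eq_empty_iff_forall_notMem.2 h)

theorem icoElem_eq_bot {x y : L} (h : y ≤ x) : icoElem x y = ⊥ :=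
  eq_bot_of_forall_notMem fun _ hu => (hu.1.trans_lt hu.2).not_ge h

theorem icoElem_ne_bot {x y : L} (h : x < y) : icoElem x y ≠ ⊥ := fun h' => by
  have : x ∈ (icoElem x y).1 := ⟨le_rfl, h⟩
  rw [h'] at this
  exact this

theorem exists_mem_of_ne_bot {a : intervalAlgebra L} (h : a ≠ ⊥) : ∃ u, u ∈ a.1 := by
  by_contra! h'
  exact h (eq_bot_of_forall_notMem h')

theorem icoElem_le_icoElem {x y x' y' : L} (hx : x' ≤ x) (hy : y ≤ y') :
    icoElem x y ≤ icoElem x' y' := Set.Ico_subset_Ico hx hy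

/-- Induction over the interval algebra. -/
theorem intervalAlgebra_induction {p : intervalAlgebra L → Prop}
    (ico : ∀ x y, x < y → p (icoElem x y)) (bot : p ⊥) (sup : ∀ a b, p a → p b → p (a ⊔ b))
    (compl : ∀ a, p a → p aᶜ) (a : intervalAlgebra L) : p a := by
  obtain ⟨s, hs⟩ := a
  induction hs using BooleanSubalgebra.closure_bot_sup_induction with
  | mem s hs =>
    obtain ⟨x, y, hxy, rfl⟩ := hs
    exact ico x y hxy
  | bot => exact bot
  | sup s hs t ht ihs iht => exact sup _ _ ihs iht
  | compl s hs ih => exact compl _ ih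

/-- Finitely many endpoints determine `s`, so it is constant near a cut. This is what makes the
filter of a cut an ultrafilter. -/
theorem exists_icoElem_le_or_le_compl {D : Set L} (h1 : D.Nonempty) (h2 : Dᶜ.Nonempty) (s : intervalAlgebra L) :
    ∃ a ∈ D, ∃ b ∉ D, icoElem a b ≤ s ∨ icoElem a b ≤ sᶜ := by
  obtain ⟨a₀, ha₀⟩ := h1
  obtain ⟨b₀, hb₀⟩ := h2
  induction s using intervalAlgebra_induction with
  | ico x y hxy =>
    by_cases hx : x ∈ D
    · by_cases hy : y ∈ D
      · exact ⟨y, hy, b₀, hb₀, Or.inr fun u hu hu' => hu.1.not_gt hu'.2⟩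
      · exact ⟨x, hx, y, hy, Or.inl le_rfl⟩
    · exact ⟨a₀, ha₀, x, hx, Or.inr fun u hu hu' => hu'.1.not_gt hu.2⟩
  | bot => exact ⟨a₀, ha₀, b₀, hb₀, Or.inr (by simp)⟩
  | sup s t ihs iht =>
    obtain ⟨a, ha, b, hb, h⟩ := ihs
    obtain ⟨a', ha', b', hb', h'⟩ := iht
    have e1 : icoElem (a ⊔ a') (b ⊓ b') ≤ icoElem a b :=
      icoElem_le_icoElem le_sup_left inf_le_left
    have e2 : icoElem (a ⊔ a') (b ⊓ b') ≤ icoElem a' b' :=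
      icoElem_le_icoElem le_sup_right inf_le_right
    refine ⟨a ⊔ a', ?_, b ⊓ b', ?_, ?_⟩
    · rcases max_choice a a' with h | h <;> rw [h] <;> assumption
    · rcases min_choice b b' with h | h <;> rw [h] <;> assumption
    · rcases h with h | h
      · exact Or.inl ((e1.trans h).trans le_sup_left)
      · rcases h' with h' | h'
        · exact Or.inl ((e2.trans h').trans le_sup_right)
        · rw [compl_sup]
          exact Or.inr (le_inf (e1.trans h) (e2.trans h'))
  | compl s ih =>
    obtain ⟨a, ha, b, hb, h⟩ := ih
    exact ⟨a, ha, b, hb, by rwa [compl_compl, or_comm]⟩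

/-- The ultrafilter generated by the intervals `[a, b)` with `a ∈ D` and `b ∉ D`. -/
def ofCut (D : Set L) (hD : IsLowerSet D) (h1 : D.Nonempty) (h2 : Dᶜ.Nonempty) :
    Ult (intervalAlgebra L) := by
  have hlt : ∀ a ∈ D, ∀ b ∉ D, a < b := fun a ha b hb => not_le.1 fun h => hb (hD h ha)
  refine Ult.ofSet {s | ∃ a ∈ D, ∃ b ∉ D, icoElem a b ≤ s} ?_ ?_ ?_ ?_ ?_
  · obtain ⟨a, ha⟩ := h1
    obtain ⟨b, hb⟩ := h2
    exact ⟨a, ha, b, hb, le_top⟩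
  · rintro ⟨a, ha, b, hb, h⟩
    exact icoElem_ne_bot (hlt a ha b hb) (le_bot_iff.1 h)
  · rintro s ⟨a, ha, b, hb, h⟩ t ⟨a', ha', b', hb', h'⟩
    refine ⟨a ⊔ a', ?_, b ⊓ b', ?_, le_inf ?_ ?_⟩
    · rcases max_choice a a' with h | h <;> rw [h] <;> assumption
    · rcases min_choice b b' with h | h <;> rw [h] <;> assumption
    · exact (icoElem_le_icoElem le_sup_left inf_le_left).trans h
    · exact (icoElem_le_icoElem le_sup_right inf_le_right).trans h'
  · rintro s t hst ⟨a, ha, b, hb, h⟩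
    exact ⟨a, ha, b, hb, h.trans hst⟩
  · intro s
    obtain ⟨a, ha, b, hb, h | h⟩ := exists_icoElem_le_or_le_compl h1 h2 s
    · exact Or.inl ⟨a, ha, b, hb, h⟩
    · exact Or.inr ⟨a, ha, b, hb, h⟩

/-- An ultrafilter that contains some interval comes from a cut. -/
theorem exists_eq_ofCut {F : Ult (intervalAlgebra L)} {a b : L} (hab : icoElem a b ∈ F.1) :
    ∃ D hD h1 h2, F = ofCut D hD h1 h2 := by
  let D : Set L := {x | ∃ y, icoElem x y ∈ F.1}
  have hb : b ∉ D := by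
    rintro ⟨y, hy⟩
    refine F.2.1 (mem_of_le ?_ (inf_mem_iff.2 ⟨hab, hy⟩))
    exact fun u hu => hu.2.1.not_gt hu.1.2
  refine ⟨D, fun x x' hx ⟨y, hy⟩ => ⟨y, mem_of_le (icoElem_le_icoElem hx le_rfl) hy⟩,
    ⟨a, b, hab⟩, ⟨b, hb⟩, (ext_of_mem ?_).symm⟩
  rintro s ⟨c, ⟨y, hy⟩, d, hd, hs⟩
  refine mem_of_le hs ?_
  have : icoElem c y ≤ icoElem c d ⊔ icoElem d y := fun u hu =>
    (lt_or_ge u d).imp (fun h => ⟨hu.1, h⟩) fun h => ⟨h, hu.2⟩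
  exact (sup_mem_iff.1 (mem_of_le this hy)).resolve_right fun h => hd ⟨y, h⟩

/-- An ultrafilter is determined by its trace on the generators; thus there is at most one point at
infinity. -/
theorem eq_of_forall_icoElem_notMem {F G : Ult (intervalAlgebra L)}
    (hF : ∀ x y, icoElem x y ∉ F.1) (hG : ∀ x y, icoElem x y ∉ G.1) : F = G := by
  suffices ∀ s, s ∈ F.1 ↔ s ∈ G.1 from ext_of_mem fun s => (this s).1
  intro s
  induction s using intervalAlgebra_induction with
  | ico x y hxy => exact iff_of_false (hF x y) (hG x y)
  | bot => exact iff_of_false F.2.1 G.2.1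
  | sup s t hs ht => rw [sup_mem_iff, sup_mem_iff, hs, ht]
  | compl s hs => rw [compl_mem_iff, compl_mem_iff, hs]

/-- The principal ultrafilter at a point of the line. -/
def pointUlt (x : L) : Ult (intervalAlgebra L) :=
  Ult.ofSet {s | x ∈ s.1} trivial (fun h => h) (fun _ ha _ hb => ⟨ha, hb⟩) (fun _ _ h ha => h ha)
    fun a => em (x ∈ a.1)

@[simp] theorem mem_pointUlt {x : L} {s : intervalAlgebra L} : s ∈ (pointUlt x).1 ↔ x ∈ s.1 :=
  Iff.rfl

theorem pointUlt_injective : Function.Injective (pointUlt (L := L)) := by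
  have : ∀ x y : L, x < y → pointUlt x ≠ pointUlt y := fun x y hxy h => by
    have h' : icoElem x y ∈ (pointUlt x).1 := ⟨le_rfl, hxy⟩
    rw [h] at h'
    exact lt_irrefl _ h'.2
  intro x y h
  rcases lt_trichotomy x y with hxy | hxy | hxy
  · exact absurd h (this _ _ hxy)
  · exact hxy
  · exact absurd h.symm (this _ _ hxy)

theorem pointUlt_eq_ofCut {x y : L} (hxy : x < y) :
    pointUlt x = ofCut (Set.Iic x) (isLowerSet_Iic x) ⟨x, le_rfl⟩ ⟨y, hxy.not_ge⟩ := by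
  refine (ext_of_mem ?_).symm
  rintro s ⟨a, ha, b, hb, hs⟩
  exact hs ⟨ha, not_le.1 hb⟩

theorem exists_icoElem_le_of_mem [NoMaxOrder L] {s : intervalAlgebra L} {x : L} (hx : x ∈ s.1) :
    ∃ y, x < y ∧ icoElem x y ≤ s := by
  obtain ⟨y, hy⟩ := exists_gt x
  have h : s ∈ (pointUlt x).1 := hx
  rw [pointUlt_eq_ofCut hy] at h
  obtain ⟨a, ha, b, hb, hs⟩ := h
  exact ⟨b, not_le.1 hb, (icoElem_le_icoElem ha le_rfl).trans hs⟩

theorem exists_ne_mem [NoMaxOrder L] [DenselyOrdered L] {F : Ult (intervalAlgebra L)}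
    {s : intervalAlgebra L} (hs : s ∈ F.1) : ∃ G, G ≠ F ∧ s ∈ G.1 := by
  obtain ⟨x, hx⟩ := exists_mem_of_ne_bot (a := s) (by rintro rfl; exact F.2.1 hs)
  obtain ⟨y, hxy, hy⟩ := exists_icoElem_le_of_mem hx
  obtain ⟨z, hxz, hzy⟩ := exists_between hxy
  by_cases h : pointUlt x = F
  · exact ⟨pointUlt z, fun h' => hxz.ne (pointUlt_injective (h.trans h'.symm)), hy ⟨hxz.le, hzy⟩⟩
  · exact ⟨pointUlt x, h, hx⟩

theorem Ult.IsCountablyDetermined.of_countable {B : Type*} [BooleanAlgebra B] {F : Ult B}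
    {V : Set B} (hV : V.Countable) (h : ∀ G : Ult B, G = F ↔ ∀ v ∈ V, v ∈ G.1) :
    F.IsCountablyDetermined := by
  obtain ⟨f, hf⟩ := (hV.insert ⊤).exists_eq_range ⟨⊤, Set.mem_insert _ _⟩
  refine ⟨f, fun G => ?_⟩
  rw [h, ← Set.forall_mem_range (p := fun v => v ∈ G.1), ← hf]
  simp

theorem isCountablyDetermined_ofCut {D : Set L} {hD : IsLowerSet D} {h1 : D.Nonempty}
    {h2 : Dᶜ.Nonempty} {C E : Set L} (hC : C ⊆ D) (hCc : C.Countable)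
    (hCD : ∀ d ∈ D, ∃ c ∈ C, d ≤ c) (hE : E ⊆ Dᶜ) (hEc : E.Countable)
    (hED : ∀ d ∈ Dᶜ, ∃ e ∈ E, e ≤ d) : (ofCut D hD h1 h2).IsCountablyDetermined := by
  refine .of_countable (V := Set.image2 icoElem C E) (hCc.image2 hEc _) fun G => ⟨?_, fun h => ?_⟩
  · rintro rfl _ ⟨c, hc, e, he, rfl⟩
    exact ⟨c, hC hc, e, hE he, le_rfl⟩
  · refine (ext_of_mem ?_).symm
    rintro s ⟨a, ha, b, hb, hs⟩
    obtain ⟨c, hc, hac⟩ := hCD a ha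
    obtain ⟨e, he, heb⟩ := hED b hb
    exact mem_of_le ((icoElem_le_icoElem hac heb).trans hs) (h _ ⟨c, hc, e, he, rfl⟩)

theorem isCountablyDetermined_of_not_hasSeq (hinc : ¬ HasIncreasingOmegaOneSeq L)
    (hdec : ¬ HasDecreasingOmegaOneSeq L) (F : Ult (intervalAlgebra L)) :
    F.IsCountablyDetermined := by
  by_cases hF : ∃ a b, icoElem a b ∈ F.1
  · obtain ⟨a, b, hab⟩ := hF
    obtain ⟨D, hD, h1, h2, rfl⟩ := exists_eq_ofCut hab
    obtain ⟨C, hC, hCc, hCD⟩ := exists_countable_cofinal hinc D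
    obtain ⟨E, hE, hEc, hED⟩ := exists_countable_coinitial hdec Dᶜ
    exact isCountablyDetermined_ofCut hC hCc hCD hE hEc hED
  · push Not at hF
    obtain ⟨C, -, hCc, hCD⟩ := exists_countable_cofinal hinc Set.univ
    obtain ⟨E, -, hEc, hED⟩ := exists_countable_coinitial hdec Set.univ
    -- The point at infinity is determined by the complements of intervals with ends in a coinitial
    -- and a cofinal set.
    refine .of_countable (V := Set.image2 (fun e c => (icoElem e c)ᶜ) E C) (hEc.image2 hCc _)
      fun G => ⟨?_, fun h => ?_⟩
    · rintro rfl _ ⟨e, he, c, hc, rfl⟩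
      exact compl_mem_iff.2 (hF e c)
    · refine eq_of_forall_icoElem_notMem (fun x y hxy => ?_) hF
      obtain ⟨c, hc, hyc⟩ := hCD y trivial
      obtain ⟨e, he, hex⟩ := hED x trivial
      exact compl_mem_iff.1 (h _ ⟨e, he, c, hc, rfl⟩) (mem_of_le (icoElem_le_icoElem hex hyc) hxy)

end Cuts

/-! ### All nonempty clopen sets are homeomorphic -/

section Interval

variable {L : Type*} [LinearOrder L]

/-- The isomorphism of relative interval algebras induced by mutually inverse monotone maps. -/
def iicIcoElemOrderIso {x y x' y' : L} (φ ψ : L → L) (hφ : Monotone φ) (hψ : Monotone ψ)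
    (hφm : ∀ u ∈ Set.Ico x y, φ u ∈ Set.Ico x' y') (hψm : ∀ v ∈ Set.Ico x' y', ψ v ∈ Set.Ico x y)
    (hψφ : ∀ u ∈ Set.Ico x y, ψ (φ u) = u) (hφψ : ∀ v ∈ Set.Ico x' y', φ (ψ v) = v)
    (hφy : ∀ u, y ≤ u → y' ≤ φ u) (hψy : ∀ v, y' ≤ v → y ≤ ψ v) :
    Set.Iic (icoElem x y) ≃o Set.Iic (icoElem x' y') := by
  have key : ∀ {x y x' y' : L} (φ ψ : L → L), Monotone φ → Monotone ψ →
      (∀ v ∈ Set.Ico x' y', ψ v ∈ Set.Ico x y) → (∀ u ∈ Set.Ico x y, ψ (φ u) = u) →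
      (∀ v ∈ Set.Ico x' y', φ (ψ v) = v) → (∀ u, y ≤ u → y' ≤ φ u) →
      ∀ s : intervalAlgebra L, {v ∈ Set.Ico x' y' | ψ v ∈ s.1} ∈ intervalAlgebra L := by
    intro x y x' y' φ ψ hφ hψ hψm hψφ hφψ hφy s
    -- This adjunction turns the preimage of `[u, w)` under `ψ` into the part of `[φ u, φ w)` in
    -- `[x', y')`.
    have gal : ∀ v ∈ Set.Ico x' y', ∀ u, u ≤ ψ v ↔ φ u ≤ v := by
      intro v hv u
      refine ⟨fun h => (hφ h).trans_eq (hφψ v hv), fun h => ?_⟩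
      rcases lt_or_ge u x with hx | hx
      · exact hx.le.trans (hψm v hv).1
      · rcases lt_or_ge u y with hy | hy
        · exact (hψφ u ⟨hx, hy⟩).symm.trans_le (hψ h)
        · exact absurd ((hφy u hy).trans h) hv.2.not_ge
    induction s using intervalAlgebra_induction with
    | ico u w _ =>
      convert (icoElem x' y' ⊓ icoElem (φ u) (φ w)).2 using 1
      ext v
      refine and_congr_right fun hv => and_congr (gal v hv u) ?_
      rw [← not_le, gal v hv w, not_le]
    | bot =>
      convert (⊥ : intervalAlgebra L).2 using 1
      exact Set.eq_empty_iff_forall_notMem.2 fun v hv => hv.2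
    | sup s t hs ht =>
      convert BooleanSubalgebra.sup_mem hs ht using 1
      ext v
      exact and_or_left
    | compl s hs =>
      convert BooleanSubalgebra.sdiff_mem (icoElem x' y').2 hs using 1
      ext v
      exact ⟨fun h => ⟨h.1, fun h' => h.2 h'.2⟩, fun h => ⟨h.1, fun h' => h.2 ⟨h.1, h'⟩⟩⟩
  refine
    { toFun := fun s => ⟨⟨_, key φ ψ hφ hψ hψm hψφ hφψ hφy s.1⟩, fun v hv => hv.1⟩
      invFun := fun s => ⟨⟨_, key ψ φ hψ hφ hφm hφψ hψφ hψy s.1⟩, fun v hv => hv.1⟩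
      left_inv := fun s => Subtype.ext (Subtype.ext (Set.ext fun u => ?_))
      right_inv := fun s => Subtype.ext (Subtype.ext (Set.ext fun v => ?_))
      map_rel_iff' := fun {s t} => ⟨fun h u hu => ?_, fun h v hv => ⟨hv.1, h hv.2⟩⟩ }
  · refine ⟨fun h => ?_, fun h => ?_⟩
    · have := h.2.2
      rwa [hψφ u h.1] at this
    · have hu := s.2 h
      refine ⟨hu, hφm u hu, ?_⟩
      rwa [hψφ u hu]
  · refine ⟨fun h => ?_, fun h => ?_⟩
    · have := h.2.2
      rwa [hφψ v h.1] at this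
    · have hv := s.2 h
      refine ⟨hv, hψm v hv, ?_⟩
      rwa [hφψ v hv]
  · have hu' := s.2 hu
    have := (h (a := φ u) ⟨hφm u hu', by rwa [hψφ u hu']⟩).2
    rwa [hψφ u hu'] at this

open Classical in
/-- The extension of a map between open intervals to the whole line, constant outside. -/
noncomputable def extendIoo (x y x' y' : L) (e : Set.Ioo x y → Set.Ioo x' y') (u : L) : L :=
  if h : u ∈ Set.Ioo x y then e ⟨u, h⟩ else if u ≤ x then x' else y'

section extendIoo

variable {x y x' y' : L} {e : Set.Ioo x y → Set.Ioo x' y'}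

theorem extendIoo_of_mem {u : L} (h : u ∈ Set.Ioo x y) :
    extendIoo x y x' y' e u = e ⟨u, h⟩ := dif_pos h

theorem extendIoo_of_le {u : L} (h : u ≤ x) : extendIoo x y x' y' e u = x' := by
  rw [extendIoo, dif_neg fun h' => h'.1.not_ge h, if_pos h]

theorem extendIoo_of_ge (hxy : x < y) {u : L} (h : y ≤ u) : extendIoo x y x' y' e u = y' := by
  rw [extendIoo, dif_neg fun h' => h'.2.not_ge h, if_neg (hxy.trans_le h).not_ge]

theorem monotone_extendIoo (hxy : x < y) (hxy' : x' < y') (he : Monotone e) :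
    Monotone (extendIoo x y x' y' e) := by
  intro u v huv
  rcases le_or_gt u x with hu | hu
  · rw [extendIoo_of_le hu]
    rcases le_or_gt v x with hv | hv
    · rw [extendIoo_of_le hv]
    · rcases le_or_gt y v with hv' | hv'
      · rw [extendIoo_of_ge hxy hv']
        exact hxy'.le
      · rw [extendIoo_of_mem ⟨hv, hv'⟩]
        exact (e ⟨v, _⟩).2.1.le
  · rcases le_or_gt y v with hv' | hv'
    · rw [extendIoo_of_ge hxy hv']
      rcases le_or_gt y u with hu' | hu'
      · rw [extendIoo_of_ge hxy hu']
      · rw [extendIoo_of_mem ⟨hu, hu'⟩]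
        exact (e ⟨u, _⟩).2.2.le
    · rw [extendIoo_of_mem ⟨hu, huv.trans_lt hv'⟩, extendIoo_of_mem ⟨hu.trans_le huv, hv'⟩]
      exact he huv

theorem extendIoo_mem_Ico (hxy' : x' < y') {u : L} (hu : u ∈ Set.Ico x y) :
    extendIoo x y x' y' e u ∈ Set.Ico x' y' := by
  rcases hu.1.eq_or_lt with rfl | h
  · rw [extendIoo_of_le le_rfl]
    exact ⟨le_rfl, hxy'⟩
  · rw [extendIoo_of_mem ⟨h, hu.2⟩]
    exact Set.Ioo_subset_Ico_self (e _).2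

theorem extendIoo_extendIoo {e' : Set.Ioo x' y' → Set.Ioo x y} (he : ∀ u, e' (e u) = u) {u : L}
    (hu : u ∈ Set.Ico x y) : extendIoo x' y' x y e' (extendIoo x y x' y' e u) = u := by
  rcases hu.1.eq_or_lt with rfl | h
  · rw [extendIoo_of_le (u := x) le_rfl, extendIoo_of_le le_rfl]
  · rw [extendIoo_of_mem ⟨h, hu.2⟩, extendIoo_of_mem (e _).2]
    exact congrArg Subtype.val (he _)

end extendIoo

theorem nonempty_basic_icoElem_homeomorph {x y x' y' : L} (hxy : x < y) (hxy' : x' < y')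
    (e : Set.Ioo x y ≃o Set.Ioo x' y') :
    Nonempty (basic (icoElem x y) ≃ₜ basic (icoElem x' y')) :=
  ⟨basicHomeomorph (iicIcoElemOrderIso (extendIoo x y x' y' e) (extendIoo x' y' x y e.symm)
    (monotone_extendIoo hxy hxy' e.monotone) (monotone_extendIoo hxy' hxy e.symm.monotone)
    (fun _ => extendIoo_mem_Ico hxy') (fun _ => extendIoo_mem_Ico hxy)
    (fun _ => extendIoo_extendIoo e.symm_apply_apply)
    (fun _ => extendIoo_extendIoo e.apply_symm_apply)
    (fun _ h => (extendIoo_of_ge hxy h).ge) fun _ h => (extendIoo_of_ge hxy' h).ge)⟩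

/-- `T` collects the endpoints used to build `s`; membership can change only on crossing one of
them. -/
theorem exists_finset_forall_mem_iff (s : intervalAlgebra L) :
    ∃ T : Finset L, ∀ u v, u ≤ v → (∀ t ∈ T, u < t → v < t) → (u ∈ s.1 ↔ v ∈ s.1) := by
  classical
  induction s using intervalAlgebra_induction with
  | ico x y _ =>
    refine ⟨{x, y}, fun u v huv h => ?_⟩
    have hx := h x (by simp)
    have hy := h y (by simp)
    refine ⟨fun hu => ⟨hu.1.trans huv, hy hu.2⟩, fun hv => ⟨?_, huv.trans_lt hv.2⟩⟩
    by_contra hxu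
    exact (hx (not_le.1 hxu)).not_ge hv.1
  | bot => exact ⟨∅, fun u v _ _ => Iff.rfl⟩
  | sup s t hs ht =>
    obtain ⟨S, hS⟩ := hs
    obtain ⟨T, hT⟩ := ht
    refine ⟨S ∪ T, fun u v huv h => or_congr (hS u v huv fun t ht => h t ?_)
      (hT u v huv fun t ht => h t ?_)⟩ <;> simp [ht]
  | compl s hs =>
    obtain ⟨S, hS⟩ := hs
    exact ⟨S, fun u v huv h => not_congr (hS u v huv h)⟩

variable {K : Type*} [TopologicalSpace K]

/-- Splitting `[x, y)` at an interior point shows `K ≃ K ⊕ K`. -/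
theorem nonempty_homeomorph_basic_sup [DenselyOrdered L] {x y : L} (hxy : x < y)
    (hK : ∀ x y : L, x < y → Nonempty (K ≃ₜ basic (icoElem x y))) {a b : intervalAlgebra L}
    (hab : Disjoint a b) (ha : Nonempty (K ≃ₜ basic a)) (hb : Nonempty (K ≃ₜ basic b)) :
    Nonempty (K ≃ₜ basic (a ⊔ b)) := by
  obtain ⟨z, hxz, hzy⟩ := exists_between hxy
  obtain ⟨f⟩ := ha
  obtain ⟨g⟩ := hb
  obtain ⟨f'⟩ := hK x z hxz
  obtain ⟨g'⟩ := hK z y hzy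
  obtain ⟨h⟩ := hK x y hxy
  have hd : Disjoint (icoElem x z) (icoElem z y) :=
    disjoint_iff_inf_le.2 fun u hu => hu.1.2.not_ge hu.2.1
  have heq : icoElem x z ⊔ icoElem z y = icoElem x y :=
    Subtype.ext (Set.Ico_union_Ico_eq_Ico hxz.le hzy.le)
  rw [← heq] at h
  exact ⟨h.trans ((sumHomeomorph hd).symm.trans
    (((f'.symm.trans f).sumCongr (g'.symm.trans g)).trans (sumHomeomorph hab)))⟩

theorem nonempty_homeomorph_basic_of_le_icoElem [DenselyOrdered L]
    (hK : ∀ x y : L, x < y → Nonempty (K ≃ₜ basic (icoElem x y))) {s : intervalAlgebra L}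
    (hs : s ≠ ⊥) {x y : L} (hsxy : s ≤ icoElem x y) : Nonempty (K ≃ₜ basic s) := by
  classical
  -- Induction on the break points: with none, `s` contains all of `[x, y)`; one lying inside splits
  -- the interval in two, and one lying outside can be dropped.
  have main : ∀ T : Finset L, ∀ x y, x < y →
      (∀ u v, x ≤ u → u ≤ v → v < y → (∀ t ∈ T, u < t → v < t) → (u ∈ s.1 ↔ v ∈ s.1)) →
      s ⊓ icoElem x y ≠ ⊥ → Nonempty (K ≃ₜ basic (s ⊓ icoElem x y)) := by
    intro T
    induction T using Finset.induction_on with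
    | empty =>
      intro x y hxy h hne
      obtain ⟨u, hu, hu'⟩ := exists_mem_of_ne_bot hne
      have hx := (h x u le_rfl hu'.1 hu'.2 (by simp)).2 hu
      have : s ⊓ icoElem x y = icoElem x y :=
        inf_eq_right.2 fun v hv => (h x v le_rfl hv.1 hv.2 (by simp)).1 hx
      rw [this]
      exact hK x y hxy
    | insert t T _ ih =>
      intro x y hxy h hne
      by_cases ht : x < t ∧ t < y
      · have h1 := ih x t ht.1 fun u v hxu huv hvt hT =>
          h u v hxu huv (hvt.trans ht.2) fun r hr => by
            rcases Finset.mem_insert.1 hr with rfl | hr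
            · exact fun _ => hvt
            · exact hT r hr
        have h2 := ih t y ht.2 fun u v htu huv hvy hT =>
          h u v (ht.1.le.trans htu) huv hvy fun r hr => by
            rcases Finset.mem_insert.1 hr with rfl | hr
            · exact fun h' => absurd h' htu.not_gt
            · exact hT r hr
        have heq : icoElem x t ⊔ icoElem t y = icoElem x y :=
          Subtype.ext (Set.Ico_union_Ico_eq_Ico ht.1.le ht.2.le)
        rw [← heq, inf_sup_left] at hne ⊢
        by_cases hb1 : s ⊓ icoElem x t = ⊥
        · rw [hb1, bot_sup_eq] at hne ⊢
          exact h2 hne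
        · by_cases hb2 : s ⊓ icoElem t y = ⊥
          · rw [hb2, sup_bot_eq] at hne ⊢
            exact h1 hne
          · refine nonempty_homeomorph_basic_sup hxy hK ?_ (h1 hb1) (h2 hb2)
            exact disjoint_iff_inf_le.2 fun u hu => hu.1.2.2.not_ge hu.2.2.1
      · refine ih x y hxy (fun u v hxu huv hvy hT => h u v hxu huv hvy fun r hr => ?_) hne
        rcases Finset.mem_insert.1 hr with rfl | hr
        · intro hur
          by_contra hvr
          exact ht ⟨hxu.trans_lt hur, (not_lt.1 hvr).trans_lt hvy⟩
        · exact hT r hr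
  obtain ⟨u, hu⟩ := exists_mem_of_ne_bot hs
  have hu' := hsxy hu
  obtain ⟨T, hT⟩ := exists_finset_forall_mem_iff s
  have heq : s ⊓ icoElem x y = s := inf_eq_left.2 hsxy
  have := main T x y (hu'.1.trans_lt hu'.2) (fun u v _ huv _ h => hT u v huv h)
  rw [heq] at this
  exact this hs

/-- By compactness: an element whose clopen set misses infinity is bounded. -/
theorem exists_le_icoElem [Nonempty L] {s : intervalAlgebra L}
    (h : ∀ F : Ult (intervalAlgebra L), s ∈ F.1 → ∃ x y, icoElem x y ∈ F.1) :
    ∃ x y, s ≤ icoElem x y := by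
  obtain ⟨p, hp⟩ := (isClosed_basic s).isCompact.elim_directed_cover
    (fun p : L × L => basic (icoElem p.1 p.2)) (fun p => isOpen_basic _)
    (fun F hF => by
      obtain ⟨x, y, hxy⟩ := h F hF
      exact Set.mem_iUnion.2 ⟨(x, y), hxy⟩)
    fun p q => ⟨(p.1 ⊓ q.1, p.2 ⊔ q.2),
      basic_subset_iff.2 (icoElem_le_icoElem inf_le_left le_sup_left),
      basic_subset_iff.2 (icoElem_le_icoElem inf_le_right le_sup_right)⟩
  exact ⟨p.1, p.2, basic_subset_iff.1 hp⟩

open OnePoint in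
theorem isHomogeneousSpace_of_isCountablyDetermined [Nonempty L] [DenselyOrdered L] [NoMaxOrder L]
    (hL : ∀ a b : L, (Set.Ioo a b).Nonempty → Nonempty (Set.Ioo a b ≃o L))
    (hdet : ∀ F : Ult (intervalAlgebra L), F.IsCountablyDetermined) :
    IsHomogeneousSpace (Ult (intervalAlgebra L)) := by
  obtain ⟨x₀⟩ := ‹Nonempty L›
  obtain ⟨y₀, hxy₀⟩ := exists_gt x₀
  let K := basic (icoElem x₀ y₀)
  let M := OnePoint (Σ _ : ℕ, K)
  have hIoo : ∀ x y : L, x < y → Nonempty (Set.Ioo x y ≃o L) := fun x y hxy =>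
    hL x y (Set.nonempty_Ioo.2 hxy)
  have hico : ∀ x y : L, x < y → Nonempty (K ≃ₜ basic (icoElem x y)) := by
    intro x y hxy
    obtain ⟨e⟩ := hIoo x y hxy
    obtain ⟨e'⟩ := hIoo x₀ y₀ hxy₀
    exact nonempty_basic_icoElem_homeomorph hxy₀ hxy (e'.trans e.symm)
  have hiso : ∀ F : Ult (intervalAlgebra L), ∀ s ∈ F.1, ∃ G, G ≠ F ∧ s ∈ G.1 :=
    fun F s hs => exists_ne_mem hs
  -- Peeling at the point `x₀` of `[x₀, y₀)` identifies `K` with `M`; peeling an unbounded element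
  -- at infinity again gives `M`, hence `K`.
  have hKM : Nonempty (K ≃ₜ M) := by
    have hx₀ : icoElem x₀ y₀ ∈ (pointUlt x₀).1 := ⟨le_rfl, hxy₀⟩
    obtain ⟨h, -⟩ := exists_homeomorph_onePoint (hdet (pointUlt x₀)) (hiso _) hx₀
      fun d hd hne _ => nonempty_homeomorph_basic_of_le_icoElem hico hne hd
    exact ⟨h.symm⟩
  have hall : ∀ s : intervalAlgebra L, s ≠ ⊥ → Nonempty (K ≃ₜ basic s) := by
    intro s hs
    by_cases hF : ∀ F : Ult (intervalAlgebra L), s ∈ F.1 → ∃ x y, icoElem x y ∈ F.1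
    · obtain ⟨x, y, hxy⟩ := exists_le_icoElem hF
      exact nonempty_homeomorph_basic_of_le_icoElem hico hs hxy
    · push Not at hF
      obtain ⟨F, hsF, hF⟩ := hF
      obtain ⟨h, -⟩ := exists_homeomorph_onePoint (K := K) (hdet F) (hiso F) hsF fun d _ hne hdF => by
        obtain ⟨x, y, hxy⟩ := exists_le_icoElem (s := d) fun G hG => by
          by_contra! hG'
          exact hdF (eq_of_forall_icoElem_notMem hG' hF ▸ hG)
        exact nonempty_homeomorph_basic_of_le_icoElem hico hne hxy
      obtain ⟨g⟩ := hKM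
      exact ⟨g.trans h⟩
  have hpt : ∀ F : Ult (intervalAlgebra L), ∃ h : M ≃ₜ Ult (intervalAlgebra L), h ∞ = F := by
    intro F
    obtain ⟨h, hh⟩ := exists_homeomorph_onePoint (K := K) (hdet F) (hiso F) (top_mem F)
      fun d _ hne _ => hall d hne
    refine ⟨h.trans ((Homeomorph.setCongr (s := basic ⊤) (Set.eq_univ_of_forall top_mem)).trans
      (Homeomorph.Set.univ _)), ?_⟩
    exact congrArg Subtype.val hh
  intro F G
  obtain ⟨f, hf⟩ := hpt F
  obtain ⟨g, hg⟩ := hpt G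
  exact ⟨f.symm.trans g, by rw [Homeomorph.trans_apply, ← hf, Homeomorph.symm_apply_apply, hg]⟩

end Interval

open Topology

/-! ### P-points and Gδ points under homogeneity -/

section Topology

/-- A point is a P-point if countable intersections of its neighbourhoods are neighbourhoods. -/
def IsPPoint {X : Type*} [TopologicalSpace X] (p : X) : Prop :=
  ∀ O : ℕ → Set X, (∀ n, O n ∈ 𝓝 p) → ⋂ n, O n ∈ 𝓝 p

variable {X : Type*} [TopologicalSpace X]

theorem IsHomogeneousSpace.isPPoint (h : IsHomogeneousSpace X) {p : X} (hp : IsPPoint p) (q : X) :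
    IsPPoint q := by
  intro O hO
  obtain ⟨f, rfl⟩ := h p q
  have := hp (fun n => f ⁻¹' O n) fun n => f.continuous.continuousAt (hO n)
  rw [← Set.preimage_iInter] at this
  rw [← f.map_nhds_eq]
  exact this

theorem IsHomogeneousSpace.isGδ_singleton (h : IsHomogeneousSpace X) {p : X} (hp : IsGδ {p})
    (q : X) : IsGδ {q} := by
  obtain ⟨f, rfl⟩ := h q p
  convert hp.preimage f.continuous using 1
  ext x
  simp

theorem isHomogeneousSpace_of_discrete [DiscreteTopology X] : IsHomogeneousSpace X := by
  classical
  intro x y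
  exact ⟨⟨Equiv.swap x y, continuous_of_discreteTopology, continuous_of_discreteTopology⟩,
    Equiv.swap_apply_left x y⟩

theorem Ult.IsCountablyDetermined.isGδ {B : Type*} [BooleanAlgebra B] {F : Ult B}
    (hF : F.IsCountablyDetermined) : IsGδ {F} := by
  obtain ⟨V, hV⟩ := hF
  have : {F} = ⋂ n, basic (V n) := by
    ext G
    simp [hV G]
  rw [this]
  exact .iInter_of_isOpen fun n => isOpen_basic _

end Topology

/-! ### Homogeneity excludes ω₁-sequences -/

section Converse

variable {L : Type*} [LinearOrder L]

/-- The intervals `[x, b)` form a neighbourhood base, so all depends on whether `(x, ∞)` has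
countable coinitiality. -/
theorem isGδ_or_isPPoint_pointUlt [NoMaxOrder L] (x : L) :
    IsGδ {pointUlt x} ∨ IsPPoint (pointUlt x) := by
  by_cases h : ∃ C ⊆ Set.Ioi x, C.Countable ∧ ∀ d ∈ Set.Ioi x, ∃ c ∈ C, c ≤ d
  · left
    obtain ⟨C, hC, hCc, hCd⟩ := h
    obtain ⟨y, hy⟩ := exists_gt x
    rw [pointUlt_eq_ofCut hy]
    refine (isCountablyDetermined_ofCut (D := Set.Iic x) (C := {x}) (E := C) (by simp) (Set.countable_singleton x)
      (fun d hd => ⟨x, rfl, hd⟩) ?_ hCc ?_).isGδ <;> rwa [Set.compl_Iic]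
  · right
    intro O hO
    have : ∀ n, ∃ b, x < b ∧ basic (icoElem x b) ⊆ O n := by
      intro n
      obtain ⟨a, ha, haO⟩ := Ult.mem_nhds_iff.1 (hO n)
      obtain ⟨b, hb, hba⟩ := exists_icoElem_le_of_mem (mem_pointUlt.1 ha)
      exact ⟨b, hb, (basic_subset_iff.2 hba).trans haO⟩
    choose b hb hbO using this
    push Not at h
    obtain ⟨d, hd, hdb⟩ := h (Set.range b) (by rintro _ ⟨n, rfl⟩; exact hb n)
      (Set.countable_range b)
    refine Ult.mem_nhds_iff.2 ⟨icoElem x d, ⟨le_rfl, hd⟩, Set.subset_iInter fun n => ?_⟩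
    exact (basic_subset_iff.2 (icoElem_le_icoElem le_rfl (hdb _ ⟨n, rfl⟩).le)).trans (hbO n)

/-- If all points were P-points, countable unions of clopen sets would be closed, hence compact; a
strictly increasing union of clopen sets is not. -/
theorem exists_not_isPPoint [Nonempty L] [NoMaxOrder L] :
    ∃ F : Ult (intervalAlgebra L), ¬ IsPPoint F := by
  by_contra! h
  obtain ⟨f, hf⟩ := Nat.exists_strictMono L
  let U := ⋃ n, basic (icoElem (f 0) (f n))
  have hU : IsClosed U := by
    rw [← isOpen_compl_iff, isOpen_iff_mem_nhds]
    intro F hF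
    rw [Set.compl_iUnion] at hF ⊢
    refine h F _ fun n => (isClosed_basic _).isOpen_compl.mem_nhds (Set.mem_iInter.1 hF n)
  have hmono : Monotone fun n => basic (icoElem (f 0) (f n)) := fun n m hnm =>
    basic_subset_iff.2 (icoElem_le_icoElem le_rfl (hf.monotone hnm))
  obtain ⟨N, hN⟩ := hU.isCompact.elim_directed_cover _ (fun n => isOpen_basic _) subset_rfl
    hmono.directed_le
  have hle := basic_subset_iff.1 ((Set.subset_iUnion
    (fun n => basic (icoElem (f 0) (f n))) (N + 1)).trans hN)
  exact lt_irrefl (f N) (hle (a := f N) ⟨hf.monotone (Nat.zero_le N), hf N.lt_succ_self⟩).2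

theorem IsHomogeneousSpace.isGδ_ult [Nonempty L] [NoMaxOrder L]
    (h : IsHomogeneousSpace (Ult (intervalAlgebra L))) (F : Ult (intervalAlgebra L)) :
    IsGδ {F} := by
  obtain ⟨x⟩ := ‹Nonempty L›
  have : Nonempty L := ⟨x⟩
  obtain ⟨G, hG⟩ := exists_not_isPPoint (L := L)
  exact h.isGδ_singleton ((isGδ_or_isPPoint_pointUlt x).resolve_right
    fun hx => hG (h.isPPoint hx G)) F

theorem exists_seq_of_isGδ_ofCut {D : Set L} {hD : IsLowerSet D} {h1 : D.Nonempty}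
    {h2 : Dᶜ.Nonempty} (h : IsGδ {ofCut D hD h1 h2}) :
    ∃ a b : ℕ → L, (∀ n, a n ∈ D) ∧ (∀ n, b n ∉ D) ∧
      ∀ x, (∀ n, a n ≤ x) → (∀ n, x < b n) → pointUlt x = ofCut D hD h1 h2 := by
  obtain ⟨O, hO, hOeq⟩ := isGδ_iff_eq_iInter_nat.1 h
  have : ∀ n, ∃ a ∈ D, ∃ b ∉ D, basic (icoElem a b) ⊆ O n := by
    intro n
    have hmem : ofCut D hD h1 h2 ∈ ⋂ n, O n := hOeq ▸ Set.mem_singleton _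
    obtain ⟨s, ⟨a, ha, b, hb, hs⟩, hsO⟩ :=
      Ult.mem_nhds_iff.1 ((hO n).mem_nhds (Set.mem_iInter.1 hmem n))
    exact ⟨a, ha, b, hb, (basic_subset_iff.2 hs).trans hsO⟩
  choose a ha b hb hab using this
  refine ⟨a, b, ha, hb, fun x hax hxb => ?_⟩
  have : pointUlt x ∈ ⋂ n, O n := Set.mem_iInter.2 fun n => hab n ⟨hax n, hxb n⟩
  rwa [← hOeq] at this

/-- Countably many lower bounds of the cut generated by `f` lie below a single `f α`, so all later
terms would induce the ultrafilter of that cut, although distinct points induce distinct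
ultrafilters. -/
theorem not_strictMono_of_isGδ (h : ∀ F : Ult (intervalAlgebra L), IsGδ {F}) {b : L}
    {f : Set.Iio (Ordinal.omega 1 : Ordinal.{0}) → L} (hb : ∀ α, f α < b) : ¬ StrictMono f := by
  intro hf
  obtain ⟨α₀, -⟩ := exists_gt_of_countable_omega_one Set.countable_empty
  let D : Set L := {d | ∃ α, d ≤ f α}
  have hD : IsLowerSet D := fun d d' hd ⟨α, hα⟩ => ⟨α, hd.trans hα⟩
  obtain ⟨a, b', ha, hb', hx⟩ := exists_seq_of_isGδ_ofCut
    (h (ofCut D hD ⟨f α₀, α₀, le_rfl⟩ ⟨b, fun ⟨α, hα⟩ => (hb α).not_ge hα⟩))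
  obtain ⟨α, hα⟩ := exists_forall_lt_of_strictMono hf (Set.countable_range a)
    (by rintro _ ⟨n, rfl⟩; exact ha n)
  obtain ⟨β, hαβ, -⟩ := exists_lt_succ_omega_one α
  have hpt : ∀ γ, α ≤ γ → pointUlt (f γ) = _ := fun γ hγ =>
    hx (f γ) (fun n => (hα _ ⟨n, rfl⟩).le.trans (hf.monotone hγ))
      fun n => not_le.1 fun h' => hb' n ⟨γ, h'⟩
  exact (hf hαβ).ne (pointUlt_injective ((hpt α le_rfl).trans (hpt β hαβ.le).symm))

theorem not_strictAnti_of_isGδ (h : ∀ F : Ult (intervalAlgebra L), IsGδ {F}) {b : L}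
    {f : Set.Iio (Ordinal.omega 1 : Ordinal.{0}) → L} (hb : ∀ α, b < f α) : ¬ StrictAnti f := by
  intro hf
  obtain ⟨α₀, -⟩ := exists_gt_of_countable_omega_one Set.countable_empty
  let D : Set L := {d | ∀ α, d < f α}
  have hD : IsLowerSet D := fun d d' hd hd' α => hd.trans_lt (hd' α)
  obtain ⟨a, b', ha, hb', hx⟩ := exists_seq_of_isGδ_ofCut
    (h (ofCut D hD ⟨b, hb⟩ ⟨f α₀, fun h' => lt_irrefl _ (h' α₀)⟩))
  obtain ⟨α, hα⟩ := exists_forall_gt_of_strictAnti hf (Set.countable_range b') (by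
    rintro _ ⟨n, rfl⟩
    by_contra! h'
    exact hb' n h')
  obtain ⟨β, hαβ, -⟩ := exists_lt_succ_omega_one α
  have hpt : ∀ γ, α ≤ γ → pointUlt (f γ) = _ := fun γ hγ =>
    hx (f γ) (fun n => (ha n γ).le) fun n => (hf.antitone hγ).trans_lt (hα _ ⟨n, rfl⟩)
  exact (hf hαβ).ne' (pointUlt_injective ((hpt α le_rfl).trans (hpt β hαβ.le).symm))

end Converse

/-! ### Separable orders -/

section Separable

variable {L : Type*} [LinearOrder L] [DenselyOrdered L]

theorem not_hasIncreasingOmegaOneSeq_of_separableSpace [TopologicalSpace L] [OrderTopology L]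
    [TopologicalSpace.SeparableSpace L] : ¬ HasIncreasingOmegaOneSeq L := by
  rintro ⟨f, hf⟩
  choose s hs hs' using exists_lt_succ_omega_one
  -- The gaps between successive terms would be uncountably many disjoint nonempty open sets.
  have hd : Pairwise fun α β => Disjoint (Set.Ioo (f α) (f (s α))) (Set.Ioo (f β) (f (s β))) := by
    have : ∀ α β, α < β → Disjoint (Set.Ioo (f α) (f (s α))) (Set.Ioo (f β) (f (s β))) :=
      fun α β hαβ => Set.disjoint_left.2 fun u hu hu' =>
        (hu'.1.trans hu.2).not_ge (hf.monotone (hs' α β hαβ))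
    exact fun α β hne => hne.lt_or_gt.elim (this α β) fun h => (this β α h).symm
  have := hd.countable_of_isOpen_disjoint (fun _ => isOpen_Ioo)
    fun α => Set.nonempty_Ioo.2 (hf (hs α))
  exact not_countable_iff.2 uncountable_Iio_omega_one this

theorem not_hasDecreasingOmegaOneSeq_of_separableSpace [TopologicalSpace L] [OrderTopology L]
    [TopologicalSpace.SeparableSpace L] : ¬ HasDecreasingOmegaOneSeq L := by
  rintro ⟨f, hf⟩
  have : TopologicalSpace.SeparableSpace Lᵒᵈ := ‹TopologicalSpace.SeparableSpace L›
  exact not_hasIncreasingOmegaOneSeq_of_separableSpace (L := Lᵒᵈ)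
    ⟨fun α => OrderDual.toDual (f α), fun _ _ h => OrderDual.toDual_lt_toDual.2 (hf h)⟩

end Separable

/-! ### The finite case and the theorem -/

section Small

variable {L : Type*} [LinearOrder L]

theorem finite_of_forall_ioo_eq_empty (h : ∀ a c b : L, a < c → ¬ c < b) : Finite L := by
  by_contra hinf
  rw [not_finite_iff_infinite] at hinf
  obtain ⟨s, hs⟩ := Infinite.exists_subset_card_eq L 3
  let e := s.orderEmbOfFin hs
  exact h (e 0) (e 1) (e 2) (e.strictMono (by decide)) (e.strictMono (by decide))

theorem isHomogeneousSpace_ult_of_finite [Finite L] :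
    IsHomogeneousSpace (Ult (intervalAlgebra L)) := by
  have : Finite (Ult (intervalAlgebra L)) :=
    Finite.of_injective (fun F => (F.1 : Set (intervalAlgebra L)))
      fun F G h => Subtype.ext (SetLike.coe_injective h)
  exact isHomogeneousSpace_of_discrete

end Small

theorem lemma3p5 {L : Type*} [LinearOrder L]
    (hL : ∀ a b : L, (Set.Ioo a b).Nonempty → Nonempty (Set.Ioo a b ≃o L)) :
    (IsHomogeneousSpace (Ult (intervalAlgebra L)) ↔
      ¬ HasIncreasingOmegaOneSeq L ∧ ¬ HasDecreasingOmegaOneSeq L) ∧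
    (@TopologicalSpace.SeparableSpace L (Preorder.topology L) →
      IsHomogeneousSpace (Ult (intervalAlgebra L))) := by
  by_cases hsmall : ∀ a c b : L, a < c → ¬ c < b
  · have := finite_of_forall_ioo_eq_empty hsmall
    have hcount : ∀ f : Set.Iio (Ordinal.omega 1 : Ordinal.{0}) → L, ¬ Function.Injective f :=
      fun f hf => not_countable_iff.2 uncountable_Iio_omega_one hf.countable
    have hhom := isHomogeneousSpace_ult_of_finite (L := L)
    exact ⟨iff_of_true hhom ⟨fun ⟨f, hf⟩ => hcount f hf.injective,
      fun ⟨f, hf⟩ => hcount f hf.injective⟩, fun _ => hhom⟩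
  push Not at hsmall
  obtain ⟨a, c, b, hac, hcb⟩ := hsmall
  have : Nonempty L := ⟨a⟩
  have : NoMaxOrder L := ⟨not_exists_isGreatest_univ hL hac hcb⟩
  have : DenselyOrdered L := ⟨fun _ _ => exists_between_of_ioo_orderIso hL hac hcb⟩
  have hback : ¬ HasIncreasingOmegaOneSeq L ∧ ¬ HasDecreasingOmegaOneSeq L →
      IsHomogeneousSpace (Ult (intervalAlgebra L)) := fun ⟨hinc, hdec⟩ =>
    isHomogeneousSpace_of_isCountablyDetermined hL (isCountablyDetermined_of_not_hasSeq hinc hdec)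
  refine ⟨⟨fun h => ?_, hback⟩, fun hsep => hback ?_⟩
  -- Pulling sequences back into `(a, b)` supplies the bound that the cut argument needs.
  · obtain ⟨e⟩ := hL a b ⟨c, hac, hcb⟩
    refine ⟨fun ⟨f, hf⟩ => ?_, fun ⟨f, hf⟩ => ?_⟩
    · exact not_strictMono_of_isGδ h.isGδ_ult (f := fun α => (e.symm (f α)).1)
        (fun α => (e.symm (f α)).2.2) fun α β hαβ => e.symm.strictMono (hf hαβ)
    · exact not_strictAnti_of_isGδ h.isGδ_ult (f := fun α => (e.symm (f α)).1)
        (fun α => (e.symm (f α)).2.1) fun α β hαβ => e.symm.strictMono (hf hαβ)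
  · let _ := Preorder.topology L
    have : OrderTopology L := ⟨rfl⟩
    exact ⟨not_hasIncreasingOmegaOneSeq_of_separableSpace,
      not_hasDecreasingOmegaOneSeq_of_separableSpace⟩
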